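/- Let $n\ge 0$ and write $\sigma(z)=z-z^{-1}$. Consider the $n\times n$ square grid whose vertices $(i,j)$ (row $i$ from the top, column $j$ from the left, $1\le i,j\le n$) all have degree four, the $4n$ boundary edges being included. A state of square ice with domain wall boundary is an orientation of all edges such that exactly two edges enter (and two leave) every vertex $(i,j)$, all left and right boundary edges point into the grid, and all top and bottom boundary edges point out of it. Given $a\in\mathbb C\setminus\{0\}$ and $\boldsymbol x=(x_1,\dots,x_n)$, $\boldsymbol y=(y_1,\dots,y_n)$ in $(\mathbb C\setminus\{0\})^n$, the vertex $(i,j)$ of a state has, with $z=x_i/y_j$, the weight $\sigma(a^2)$ if its two horizontal edges have opposite directions (both enter or both leave the vertex); the weight $\sigma(az)$ if its horizontal edges both point right and its vertical edges both point up, or its horizontal edges both point left and its vertical edges both point down; and the weight $\sigma(az^{-1})$ if its horizontal edges both point right and its vertical edges both point down, or its horizontal edges both point left and its vertical edges both point up. The weight of a state is the product of the weights of its $n^2$ vertices, and the partition function $Z(n;\boldsymbol x,\boldsymbol y)$ is the sum of the weights of all states. Then, for $a=e^{\mathrm i\pi/3}$, the function $Z(n;\boldsymbol x,\boldsymbol y)$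 is symmetric in the union of the coordinates of $\boldsymbol x$ and $\boldsymbol y$: if $(x_1',\dots,x_n',y_1',\dots,y_n')$ is any permutation of $(x_1,\dots,x_n,y_1,\dots,y_n)$, then $Z(n;\boldsymbol x',\boldsymbol y')=Z(n;\boldsymbol x,\boldsymbol y)$. -/

import Mathlib

namespace SquareIce

/-- The abbreviation `σ(x) = x - x⁻¹`. -/
noncomputable def sigma (x : ℂ) : ℂ := x - x⁻¹

/-- An orientation of all edges of the `n × n` square grid together with its `4n` boundary edges.
Rows are numbered from top to bottom and columns from left to right, starting at `0`.

The first component orients the horizontal edges: in row `i`, edge `j` (with `0 ≤ j ≤ n`) joins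
column `j - 1` to column `j` (so `0` is the left and `n` the right boundary edge), and `true` means
that it points to the right.

The second component orients the vertical edges: in column `j`, edge `i` (with `0 ≤ i ≤ n`) joins
row `i - 1` to row `i` (so `0` is the top and `n` the bottom boundary edge), and `true` means that
it points up. -/
abbrev Orientation (n : ℕ) : Type :=
  (Fin n → Fin (n + 1) → Bool) × (Fin (n + 1) → Fin n → Bool)

namespace Orientation

variable {n : ℕ}

/-- Does the edge to the left of the vertex in row `i` and column `j` point to the right? -/
def left (s : Orientation n) (i j : Fin n) : Bool := s.1 i j.castSucc

/-- Does the edge to the right of the vertex in row `i` and column `j` point to the right? -/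
def right (s : Orientation n) (i j : Fin n) : Bool := s.1 i j.succ

/-- Does the edge above the vertex in row `i` and column `j` point up? -/
def above (s : Orientation n) (i j : Fin n) : Bool := s.2 i.castSucc j

/-- Does the edge below the vertex in row `i` and column `j` point up? -/
def below (s : Orientation n) (i j : Fin n) : Bool := s.2 i.succ j

/-- The number of edges that enter the tetravalent vertex in row `i` and column `j`. -/
def inDegree (s : Orientation n) (i j : Fin n) : ℕ :=
  (if s.left i j = true then 1 else 0) + (if s.right i j = false then 1 else 0) +
    (if s.above i j = false then 1 else 0) + (if s.below i j = true then 1 else 0)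

/-- The ice rule (at each tetravalent vertex two edges enter, hence two leave) and the domain wall
boundary condition (horizontal boundary edges point into the grid, vertical ones out of it). -/
def IsState (s : Orientation n) : Prop :=
  (∀ i j, s.inDegree i j = 2) ∧
    (∀ i, s.1 i 0 = true ∧ s.1 i (Fin.last n) = false) ∧
    (∀ j, s.2 0 j = true ∧ s.2 (Fin.last n) j = false)

instance : DecidablePred (IsState (n := n)) := fun s => by
  unfold IsState
  infer_instance

/-- The weight, at spectral parameter `z`, of the vertex in row `i` and column `j` of a state.
By the ice rule there are six kinds of vertices. If the two horizontal edges point against each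
other (then so do the two vertical ones) the weight is `σ(a²)`. Otherwise both lines go straight
through the vertex: the weight is `σ(a z)` for the directions right/up and left/down and `σ(a z⁻¹)`
for the directions right/down and left/up. -/
noncomputable def vertexWeight (a : ℂ) (s : Orientation n) (i j : Fin n) (z : ℂ) : ℂ :=
  if s.left i j ≠ s.right i j then sigma (a ^ 2)
  else if s.left i j = s.above i j then sigma (a * z)
  else sigma (a * z⁻¹)

/-- The weight of a state; the row `i` carries `x i`, the column `j` carries `y j`, and the vertex
at their intersection has the spectral parameter `x i / y j`. -/
noncomputable def weight (a : ℂ) (x y : Fin n → ℂ) (s : Orientation n) : ℂ :=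
  ∏ i, ∏ j, s.vertexWeight a i j (x i / y j)

end Orientation

/-- The partition function `Z(n; x, y)` of the square ice model with domain wall boundary. -/
noncomputable def partitionFunction (a : ℂ) (n : ℕ) (x y : Fin n → ℂ) : ℂ :=
  ∑ s : Orientation n with s.IsState, s.weight a x y

end SquareIce

/-! The Yang–Baxter equation makes the transfer matrices of two rows commute, so `Z` is symmetric
in `x`. Reflecting the grid in its diagonal turns this into symmetry in `y`, and reflecting it in a
vertical axis shows that `Z` is invariant under the inversion of all parameters.

As a function of `x₁` alone, `Z` is a Laurent polynomial with exponents between `-(n - 1)` and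
`n - 1`, since every row contains a vertex of weight `σ(a²)`; hence it is determined by `2 n - 1`
values. Where `σ(a x₁ / y₁) = 0`, the orientations in the first row and column are forced, and `Z`
is an explicit product times the partition function of the remaining grid. By the symmetries, this
happens at `x₁ = ± a⁻¹ yⱼ` and `x₁ = ± a yⱼ` for every `j`.

If `a⁶ = 1`, that product is symmetric in all remaining parameters. By induction, exchanging `xₙ`
with `yₙ` thus preserves `Z` at the points `a⁻¹ yⱼ`, `- a⁻¹ yⱼ` and `a yⱼ` with `j < n`. For
`a² ≠ 1` and generic `y` these are `3 (n - 1)` points, more than enough when `n ≥ 2`; continuity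
removes the genericity assumption. This exchange and the permutations within `x` and within `y`
generate the full symmetric group. -/

namespace SquareIce

open scoped Kronecker

section MatrixProducts

variable {ι κ R : Type*} [Fintype ι] [DecidableEq ι] [Fintype κ] [DecidableEq κ] [CommSemiring R]

theorem prod_ofFn_apply {n : ℕ} (M : Fin n → Matrix ι ι R) (p q : ι) :
    (List.ofFn M).prod p q =
      ∑ v : Fin (n + 1) → ι with v 0 = p ∧ v (Fin.last n) = q,
        ∏ i, M i (v i.castSucc) (v i.succ) := by
  simp only [Finset.sum_filter]
  induction n generalizing p with
  | zero =>
    rw [← (Equiv.funUnique (Fin 1) ι).symm.sum_comp]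
    simp [Matrix.one_apply, ite_and]
  | succ n ih =>
    rw [← (Fin.consEquiv fun _ : Fin (n + 2) => ι).sum_comp, Fintype.sum_prod_type_right,
      List.ofFn_succ, List.prod_cons, Matrix.mul_apply]
    simp only [ih, Finset.mul_sum]
    rw [Finset.sum_comm]
    simp [Fin.consEquiv, Fin.prod_univ_succ, ← Fin.succ_last, ite_and]

theorem prod_ofFn_kronecker {n : ℕ} (A : Fin n → Matrix ι ι R) (B : Fin n → Matrix κ κ R) :
    (List.ofFn fun j => A j ⊗ₖ B j).prod = (List.ofFn A).prod ⊗ₖ (List.ofFn B).prod := by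
  induction n with
  | zero => simp
  | succ n ih => simp [List.ofFn_succ, ih, Matrix.mul_kronecker_mul]

end MatrixProducts

theorem prod_ofFn_sum {κ A : Type*} [Fintype κ] [Semiring A] {n : ℕ} (f : Fin n → κ → A) :
    (List.ofFn fun j => ∑ c, f j c).prod =
      ∑ γ : Fin n → κ, (List.ofFn fun j => f j (γ j)).prod := by
  simpa only [MultilinearMap.mkPiAlgebraFin_apply] using
    (MultilinearMap.mkPiAlgebraFin ℕ n A).map_sum f

theorem semiconjBy_prod_ofFn {M : Type*} [Monoid M] {n : ℕ} {r : M} {A B : Fin n → M}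
    (h : ∀ j, SemiconjBy r (A j) (B j)) :
    SemiconjBy r (List.ofFn A).prod (List.ofFn B).prod := by
  induction n with
  | zero => simp
  | succ n ih =>
    simp only [List.ofFn_succ, List.prod_cons]
    exact (h 0).mul_right (ih fun j => h j.succ)

namespace Orientation

variable {n : ℕ}

theorem inDegree_eq_two_iff (s : Orientation n) (i j : Fin n) :
    s.inDegree i j = 2 ↔ (s.left i j).toNat + (s.below i j).toNat =
      (s.right i j).toNat + (s.above i j).toNat := by
  unfold inDegree
  cases s.left i j <;> cases s.right i j <;> cases s.above i j <;> cases s.below i j <;> simp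

/-- The domain wall boundary condition: horizontal boundary edges point into the grid, vertical
ones out of it. Unlike `IsState`, this does not include the ice rule. -/
def HasDomainWallBoundary (s : Orientation n) : Prop :=
  (∀ i, s.1 i 0 = true ∧ s.1 i (Fin.last n) = false) ∧
    (∀ j, s.2 0 j = true ∧ s.2 (Fin.last n) j = false)

instance : DecidablePred (HasDomainWallBoundary (n := n)) := fun s => by
  unfold HasDomainWallBoundary
  infer_instance

end Orientation

/-- The weight at spectral parameter `z` of a vertex whose upper, lower, left and right edge are
oriented by `u`, `d`, `l`, `r` in the convention of `Orientation`. It vanishes unless the ice rule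
holds, which is expressed as conservation of the number of `true` edges from the lower left to the
upper right. -/
noncomputable def localWeight (a z : ℂ) (u d l r : Bool) : ℂ :=
  if l.toNat + d.toNat = r.toNat + u.toNat then
    if l ≠ r then sigma (a ^ 2) else if l = u then sigma (a * z) else sigma (a * z⁻¹)
  else 0

theorem localWeight_transpose (a z : ℂ) (u d l r : Bool) :
    localWeight a z l r u d = localWeight a z u d l r := by
  cases u <;> cases d <;> cases l <;> cases r <;> simp [localWeight]

theorem localWeight_reflect (a z : ℂ) (u d l r : Bool) :
    localWeight a z⁻¹ u d (!r) (!l) = localWeight a z u d l r := by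
  cases u <;> cases d <;> cases l <;> cases r <;> simp [localWeight]

theorem partitionFunction_eq_sum_localWeight (a : ℂ) {n : ℕ} (x y : Fin n → ℂ) :
    partitionFunction a n x y = ∑ s : Orientation n with s.HasDomainWallBoundary,
      ∏ i, ∏ j, localWeight a (x i / y j) (s.above i j) (s.below i j) (s.left i j)
        (s.right i j) := by
  have hw (s : Orientation n) :
      ∏ i, ∏ j, localWeight a (x i / y j) (s.above i j) (s.below i j) (s.left i j) (s.right i j) =
        if ∀ i j, s.inDegree i j = 2 then s.weight a x y else 0 := by
    split_ifs with h
    · exact Finset.prod_congr rfl fun i _ => Finset.prod_congr rfl fun j _ =>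
        if_pos ((s.inDegree_eq_two_iff i j).1 (h i j))
    · push Not at h
      obtain ⟨i, j, hij⟩ := h
      exact Finset.prod_eq_zero (Finset.mem_univ i) (Finset.prod_eq_zero (Finset.mem_univ j)
        (if_neg (mt (s.inDegree_eq_two_iff i j).2 hij)))
  simp only [hw]
  rw [← Finset.sum_filter, Finset.filter_filter]
  refine Finset.sum_congr ?_ fun _ _ => rfl
  ext s
  simp only [Finset.mem_filter_univ]
  exact and_comm

section Reflections

variable (a : ℂ) {n : ℕ} (x y : Fin n → ℂ)

theorem partitionFunction_eq_of_equiv {x' y' : Fin n → ℂ} (e : Orientation n ≃ Orientation n)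
    (he : ∀ s, (e s).HasDomainWallBoundary ↔ s.HasDomainWallBoundary)
    (hw : ∀ s : Orientation n,
      ∏ i, ∏ j, localWeight a (x' i / y' j) ((e s).above i j) ((e s).below i j) ((e s).left i j)
        ((e s).right i j) =
      ∏ i, ∏ j, localWeight a (x i / y j) (s.above i j) (s.below i j) (s.left i j)
        (s.right i j)) :
    partitionFunction a n x' y' = partitionFunction a n x y := by
  simp only [partitionFunction_eq_sum_localWeight]
  symm
  exact Finset.sum_equiv e (fun s => by simp [he]) fun s _ => (hw s).symm

/-- The reflection of an orientation in the main diagonal, followed by the reversal of all edges,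
so that the domain wall boundary condition is preserved. -/
def transposeEquiv (n : ℕ) : Orientation n ≃ Orientation n where
  toFun s := (fun i j => s.2 j i, fun i j => s.1 j i)
  invFun s := (fun i j => s.2 j i, fun i j => s.1 j i)
  left_inv _ := rfl
  right_inv _ := rfl

theorem partitionFunction_transpose :
    partitionFunction a n (fun i => (y i)⁻¹) (fun j => (x j)⁻¹) = partitionFunction a n x y := by
  refine partitionFunction_eq_of_equiv a x y (transposeEquiv n) (fun s => and_comm) fun s => ?_
  rw [Finset.prod_comm]
  simp only [inv_div_inv]
  exact Finset.prod_congr rfl fun i _ => Finset.prod_congr rfl fun j _ =>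
    localWeight_transpose _ _ _ _ _ _

/-- The reflection of an orientation in the vertical axis. -/
def reflectEquiv (n : ℕ) : Orientation n ≃ Orientation n where
  toFun s := (fun i j => !s.1 i j.rev, fun i j => s.2 i j.rev)
  invFun s := (fun i j => !s.1 i j.rev, fun i j => s.2 i j.rev)
  left_inv s := by simp
  right_inv s := by simp

theorem hasDomainWallBoundary_reflectEquiv (s : Orientation n) :
    (reflectEquiv n s).HasDomainWallBoundary ↔ s.HasDomainWallBoundary := by
  refine and_congr (forall_congr' fun i => ?_) (Fin.revPerm.forall_congr fun j => ?_)
  · simp [reflectEquiv, and_comm]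
  · simp [reflectEquiv]

theorem partitionFunction_reflect :
    partitionFunction a n (fun i => (x i)⁻¹) (fun j => (y j.rev)⁻¹) =
      partitionFunction a n x y := by
  refine partitionFunction_eq_of_equiv a x y (reflectEquiv n)
    hasDomainWallBoundary_reflectEquiv fun s => Finset.prod_congr rfl fun i _ => ?_
  rw [← Equiv.prod_comp Fin.revPerm]
  refine Finset.prod_congr rfl fun j _ => ?_
  simp only [Orientation.above, Orientation.below, Orientation.left, Orientation.right,
    reflectEquiv, Equiv.coe_fn_mk, Fin.revPerm_apply, Fin.rev_rev, Fin.rev_castSucc, Fin.rev_succ,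
    inv_div_inv, ← inv_div (x i) (y j), localWeight_reflect]

end Reflections

section YangBaxter

variable (a : ℂ)

/-- The matrix of the local weights with fixed vertical edges, indexed by the left and right edge
of the vertex. -/
noncomputable def lMatrix (z : ℂ) (u d : Bool) : Matrix Bool Bool ℂ :=
  Matrix.of (localWeight a z u d)

/-- The matrix of the weights of two vertices with parameters `z` and `w`, the first one on top of
the second one, summed over the edge between them. The rows and columns are indexed by the two
left and the two right edges. -/
noncomputable def doubleMatrix (z w : ℂ) (u d : Bool) : Matrix (Bool × Bool) (Bool × Bool) ℂ :=
  ∑ c, lMatrix a z u c ⊗ₖ lMatrix a w c d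

/-- The `R`-matrix of the six-vertex model, which exchanges two horizontal lines with parameters
`z` and `w` in the Yang–Baxter equation. It depends on the ratio `z / w` only. -/
noncomputable def rMatrix (z w : ℂ) : Matrix (Bool × Bool) (Bool × Bool) ℂ :=
  Matrix.of fun p q =>
    if p = q then if p.1 = p.2 then sigma (a ^ 2 * (w / z)) else sigma (a ^ 2)
    else if p = q.swap then sigma (z / w) else 0

/-- The transfer matrix of a row with parameter `t` whose left and right boundary edges point into
the grid, indexed by the vertical edges above and below the row. -/
noncomputable def transfer {n : ℕ} (y : Fin n → ℂ) (t : ℂ) :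
    Matrix (Fin n → Bool) (Fin n → Bool) ℂ :=
  Matrix.of fun α β => (List.ofFn fun j => lMatrix a (t / y j) (α j) (β j)).prod true false

theorem yang_baxter {a z w : ℂ} (ha : a ≠ 0) (hz : z ≠ 0) (hw : w ≠ 0) (u d : Bool) :
    SemiconjBy (rMatrix a z w) (doubleMatrix a z w u d) (doubleMatrix a w z u d) := by
  unfold SemiconjBy
  ext ⟨p₁, p₂⟩ ⟨q₁, q₂⟩
  simp only [doubleMatrix, rMatrix, lMatrix, Matrix.mul_apply, Fintype.sum_prod_type,
    Fintype.sum_bool, Matrix.add_apply, Matrix.kroneckerMap_apply, Matrix.of_apply]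
  cases u <;> cases d <;> cases p₁ <;> cases p₂ <;> cases q₁ <;> cases q₂ <;>
    simp only [localWeight, sigma, Bool.toNat_true, Bool.toNat_false, Nat.reduceAdd,
      Nat.reduceEqDiff, reduceIte, reduceCtorEq, ne_eq, not_true, not_false_iff, Prod.mk.injEq,
      Prod.swap_prod_mk, and_self, and_true, and_false, zero_mul, mul_zero, add_zero,
      zero_add] <;>
    field_simp <;> ring

theorem transfer_mul_transfer_apply {n : ℕ} (y : Fin n → ℂ) (t s : ℂ) (α β : Fin n → Bool) :
    (transfer a y t * transfer a y s) α β =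
      (List.ofFn fun j => doubleMatrix a (t / y j) (s / y j) (α j) (β j)).prod
        (true, true) (false, false) := by
  simp only [doubleMatrix, prod_ofFn_sum, prod_ofFn_kronecker, Matrix.sum_apply,
    Matrix.kroneckerMap_apply]
  rfl

theorem rMatrix_div_div (z w : ℂ) {c : ℂ} (hc : c ≠ 0) :
    rMatrix a (z / c) (w / c) = rMatrix a z w := by
  simp only [rMatrix, div_div_div_cancel_right₀ hc]

theorem rMatrix_mul_apply_true_true_false_false (z w : ℂ)
    (M : Matrix (Bool × Bool) (Bool × Bool) ℂ) :
    (rMatrix a z w * M) (true, true) (false, false) =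
      sigma (a ^ 2 * (w / z)) * M (true, true) (false, false) := by
  simp [rMatrix, Matrix.mul_apply, Fintype.sum_prod_type]

theorem mul_rMatrix_apply_true_true_false_false (z w : ℂ)
    (M : Matrix (Bool × Bool) (Bool × Bool) ℂ) :
    (M * rMatrix a z w) (true, true) (false, false) =
      M (true, true) (false, false) * sigma (a ^ 2 * (w / z)) := by
  simp [rMatrix, Matrix.mul_apply, Fintype.sum_prod_type]

variable {a}

theorem commute_transfer {n : ℕ} {y : Fin n → ℂ} {t s : ℂ} (ha : a ≠ 0)
    (hy : ∀ j, y j ≠ 0) (ht : t ≠ 0) (hs : s ≠ 0) (h : sigma (a ^ 2 * (s / t)) ≠ 0) :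
    Commute (transfer a y t) (transfer a y s) := by
  ext α β
  rw [transfer_mul_transfer_apply, transfer_mul_transfer_apply]
  have hR : SemiconjBy (rMatrix a t s)
      (List.ofFn fun j => doubleMatrix a (t / y j) (s / y j) (α j) (β j)).prod
      (List.ofFn fun j => doubleMatrix a (s / y j) (t / y j) (α j) (β j)).prod :=
    semiconjBy_prod_ofFn fun j => rMatrix_div_div a t s (hy j) ▸
      yang_baxter ha (div_ne_zero ht (hy j)) (div_ne_zero hs (hy j)) (α j) (β j)
  have hentry := congrFun₂ hR.eq (true, true) (false, false)
  rw [rMatrix_mul_apply_true_true_false_false, mul_rMatrix_apply_true_true_false_false,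
    mul_comm] at hentry
  exact mul_right_cancel₀ h hentry

theorem partitionFunction_eq_prod_transfer (a : ℂ) {n : ℕ} (x y : Fin n → ℂ) :
    partitionFunction a n x y =
      (List.ofFn fun i => transfer a y (x i)).prod (fun _ => true) (fun _ => false) := by
  simp only [partitionFunction_eq_sum_localWeight, transfer, lMatrix, prod_ofFn_apply,
    Matrix.of_apply, Finset.prod_univ_sum]
  rw [← Finset.sum_product_right']
  refine Finset.sum_congr ?_ fun _ _ => rfl
  ext s
  simp only [Finset.mem_filter_univ, Finset.mem_product, Fintype.mem_piFinset, funext_iff,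
    Orientation.HasDomainWallBoundary, forall_and]

theorem partitionFunction_comp_perm_left_of_sigma_ne_zero {n : ℕ} {x y : Fin n → ℂ} (ha : a ≠ 0)
    (hx : ∀ i, x i ≠ 0) (hy : ∀ j, y j ≠ 0)
    (hσ : ∀ i j, i ≠ j → sigma (a ^ 2 * (x j / x i)) ≠ 0) (e : Equiv.Perm (Fin n)) :
    partitionFunction a n (x ∘ e) y = partitionFunction a n x y := by
  rw [partitionFunction_eq_prod_transfer, partitionFunction_eq_prod_transfer]
  have hperm : (List.ofFn fun i => transfer a y ((x ∘ e) i)).Perm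
      (List.ofFn fun i => transfer a y (x i)) :=
    e.ofFn_comp_perm fun i => transfer a y (x i)
  rw [hperm.prod_eq' (List.pairwise_ofFn.2 fun i j hij => ?_)]
  exact commute_transfer ha hy (hx _) (hx _) (hσ _ _ (e.injective.ne hij.ne))

end YangBaxter

section Continuity

theorem continuousOn_sigma : ContinuousOn sigma {0}ᶜ :=
  continuousOn_id.sub continuousOn_inv₀

theorem continuousOn_partitionFunction {a : ℂ} (ha : a ≠ 0) (n : ℕ) :
    ContinuousOn (fun p : (Fin n → ℂ) × (Fin n → ℂ) => partitionFunction a n p.1 p.2)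
      {p | (∀ i, p.1 i ≠ 0) ∧ ∀ j, p.2 j ≠ 0} := by
  refine continuousOn_finsetSum _ fun s _ => continuousOn_finsetProd _ fun i _ =>
    continuousOn_finsetProd _ fun j _ => ?_
  have hratio : ContinuousOn (fun p : (Fin n → ℂ) × (Fin n → ℂ) => p.1 i / p.2 j)
      {p | (∀ i, p.1 i ≠ 0) ∧ ∀ j, p.2 j ≠ 0} :=
    ContinuousOn.div (by fun_prop) (by fun_prop) fun p hp => hp.2 j
  unfold Orientation.vertexWeight
  split_ifs
  · exact continuousOn_const
  · exact continuousOn_sigma.comp (continuousOn_const.mul hratio) fun p hp =>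
      mul_ne_zero ha (div_ne_zero (hp.1 i) (hp.2 j))
  · exact continuousOn_sigma.comp
      (continuousOn_const.mul (hratio.inv₀ fun p hp => div_ne_zero (hp.1 i) (hp.2 j)))
      fun p hp => mul_ne_zero ha (inv_ne_zero (div_ne_zero (hp.1 i) (hp.2 j)))

/-- The nonzero vectors without a prescribed ratio `c` between the absolute values of two
coordinates. -/
def genericVectors (n : ℕ) (c : ℝ) : Set (Fin n → ℂ) :=
  {z | (∀ j, z j ≠ 0) ∧ ∀ i j, i ≠ j → ‖z i‖ ≠ c * ‖z j‖}

theorem mem_closure_genericVectors {n : ℕ} (c : ℝ) {y : Fin n → ℂ} (hy : ∀ j, y j ≠ 0) :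
    y ∈ closure (genericVectors n c) := by
  let γ (ε : ℝ) (j : Fin n) : ℂ := y j * Real.exp (ε * j)
  have hγ : Filter.Tendsto γ (nhdsWithin 0 {0}ᶜ) (nhds y) := by
    have hcont : Continuous γ := by fun_prop
    simpa [γ] using (hcont.tendsto 0).mono_left nhdsWithin_le_nhds
  have hnorm (ε : ℝ) (j : Fin n) : ‖γ ε j‖ = ‖y j‖ * Real.exp (ε * j) := by
    rw [norm_mul, Complex.norm_real, Real.norm_eq_abs, Real.abs_exp]
  refine mem_closure_of_tendsto hγ (.and ?_ ?_)
  · exact .of_forall fun ε j => mul_ne_zero (hy j) (by simp)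
  simp only [Filter.eventually_all]
  intro i j hij
  by_cases hc : ‖y i‖ = c * ‖y j‖
  · filter_upwards [self_mem_nhdsWithin] with ε hε h
    rw [hnorm, hnorm, ← mul_assoc, ← hc, mul_right_inj' (norm_ne_zero_iff.2 (hy i)),
      Real.exp_eq_exp, mul_right_inj' hε, Nat.cast_inj] at h
    exact hij (Fin.ext h)
  · have hcont : Filter.Tendsto (fun ε => ‖γ ε i‖ - c * ‖γ ε j‖) (nhdsWithin 0 {0}ᶜ)
        (nhds (‖y i‖ - c * ‖y j‖)) :=
      (tendsto_pi_nhds.1 hγ i).norm.sub ((tendsto_pi_nhds.1 hγ j).norm.const_mul c)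
    filter_upwards [hcont.eventually_ne (sub_ne_zero.2 hc)] with ε hε using sub_ne_zero.1 hε

end Continuity

section Permutations

variable {a : ℂ} {n : ℕ} {x y : Fin n → ℂ}

theorem sigma_eq_zero_iff {z : ℂ} (hz : z ≠ 0) : sigma z = 0 ↔ z ^ 2 = 1 := by
  rw [sigma, sub_eq_zero, ← mul_eq_one_iff_eq_inv₀ hz, sq]

theorem norm_eq_of_sigma_div_eq_zero {b s t : ℂ} (hb : b ≠ 0) (hs : s ≠ 0) (ht : t ≠ 0)
    (h : sigma (b * (s / t)) = 0) : ‖t‖ = ‖b‖ * ‖s‖ := by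
  rw [sigma_eq_zero_iff (mul_ne_zero hb (div_ne_zero hs ht))] at h
  have hone := Complex.norm_eq_one_of_pow_eq_one h two_ne_zero
  rwa [norm_mul, norm_div, ← mul_div_assoc, div_eq_one_iff_eq (norm_ne_zero_iff.2 ht), eq_comm]
    at hone

theorem partitionFunction_comp_perm_left (ha : a ≠ 0) (hx : ∀ i, x i ≠ 0) (hy : ∀ j, y j ≠ 0)
    (e : Equiv.Perm (Fin n)) :
    partitionFunction a n (x ∘ e) y = partitionFunction a n x y := by
  have hcont := continuousOn_partitionFunction ha n
  have heq : Set.EqOn (fun u => partitionFunction a n (u ∘ e) y)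
      (fun u => partitionFunction a n u y) (genericVectors n ‖a ^ 2‖) := fun u hu =>
    partitionFunction_comp_perm_left_of_sigma_ne_zero ha hu.1 hy (fun i j hij h =>
      hu.2 i j hij (norm_eq_of_sigma_div_eq_zero (pow_ne_zero 2 ha) (hu.1 j) (hu.1 i) h)) e
  refine heq.of_subset_closure (t := {u | ∀ i, u i ≠ 0})
    (hcont.comp (f := fun u => (u ∘ e, y)) (Continuous.continuousOn (by fun_prop))
      fun u hu => ⟨fun i => hu (e i), hy⟩)
    (hcont.comp (f := fun u => (u, y)) (Continuous.continuousOn (by fun_prop))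
      fun u hu => ⟨hu, hy⟩)
    (fun u hu => hu.1) (fun u => mem_closure_genericVectors _) hx

theorem partitionFunction_comp_perm_right (ha : a ≠ 0) (hx : ∀ i, x i ≠ 0) (hy : ∀ j, y j ≠ 0)
    (e : Equiv.Perm (Fin n)) :
    partitionFunction a n x (y ∘ e) = partitionFunction a n x y := by
  rw [← partitionFunction_transpose, ← partitionFunction_transpose a x y]
  exact partitionFunction_comp_perm_left ha (fun j => inv_ne_zero (hy j))
    (fun i => inv_ne_zero (hx i)) e

theorem partitionFunction_inv (ha : a ≠ 0) (hx : ∀ i, x i ≠ 0) (hy : ∀ j, y j ≠ 0) :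
    partitionFunction a n x⁻¹ y⁻¹ = partitionFunction a n x y := by
  rw [← partitionFunction_reflect a x y]
  exact (partitionFunction_comp_perm_right ha (fun i => inv_ne_zero (hx i))
    (fun j => inv_ne_zero (hy j)) Fin.revPerm).symm

end Permutations

namespace Orientation

variable {n : ℕ}

theorem isState_transposeEquiv {s : Orientation n} :
    (transposeEquiv n s).IsState ↔ s.IsState := by
  refine and_congr (forall_comm.trans (forall₂_congr fun i j => ?_)) and_comm
  rw [inDegree_eq_two_iff, inDegree_eq_two_iff]
  change (s.above i j).toNat + (s.right i j).toNat = (s.below i j).toNat + (s.left i j).toNat ↔ _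
  omega

theorem right_eq_false_and_below_eq_true {s : Orientation n} {i j : Fin n}
    (h : s.inDegree i j = 2) (hl : s.left i j = false) (hu : s.above i j = true) :
    s.right i j = false ∧ s.below i j = true := by
  rw [inDegree_eq_two_iff, hl, hu] at h
  cases hr : s.right i j <;> cases hd : s.below i j <;> simp_all

theorem below_eq_right_of_left_eq_above {s : Orientation n} {i j : Fin n}
    (h : s.inDegree i j = 2) (hlu : s.left i j = s.above i j) : s.below i j = s.right i j := by
  rw [inDegree_eq_two_iff, hlu] at h
  cases hr : s.right i j <;> cases hd : s.below i j <;> simp_all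

theorem IsState.exists_left_ne_right {s : Orientation n} (hs : s.IsState) (i : Fin n) :
    ∃ j, s.left i j ≠ s.right i j := by
  by_contra! hc
  have hrow (j : Fin (n + 1)) : s.1 i j = true := by
    induction j using Fin.induction with
    | zero => exact (hs.2.1 i).1
    | succ j ih => exact (hc j).symm.trans ih
  exact Bool.false_ne_true ((hs.2.1 i).2.symm.trans (hrow _))

theorem IsState.first_row {t : Orientation (n + 1)} (ht : t.IsState)
    (hcorner : t.right 0 0 = false) (j : Fin (n + 1)) : t.right 0 j = false := by
  induction j using Fin.induction with
  | zero => exact hcorner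
  | succ j ih => exact (right_eq_false_and_below_eq_true (ht.1 0 j.succ) ih (ht.2.2 j.succ).1).1

theorem IsState.first_column {t : Orientation (n + 1)} (ht : t.IsState)
    (hcorner : t.right 0 0 = false) (i : Fin (n + 1)) : t.below i 0 = false :=
  (isState_transposeEquiv.2 ht).first_row ((below_eq_right_of_left_eq_above (ht.1 0 0)
    ((ht.2.1 0).1.trans (ht.2.2 0).1.symm)).trans hcorner) i

/-- The extension of an orientation to a grid with a new first row and a new first column in which
only the vertex in the corner has opposite horizontal edges. -/
def extendCorner (s : Orientation n) : Orientation (n + 1) :=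
  (Fin.cons (Fin.cons true fun _ => false) fun i => Fin.cons true (s.1 i),
    Fin.cons (fun _ => true) fun i => Fin.cons false (s.2 i))

/-- The restriction of an orientation to the grid without the first row and the first column. -/
def restrictCorner (t : Orientation (n + 1)) : Orientation n :=
  (fun i j => t.1 i.succ j.succ, fun i j => t.2 i.succ j.succ)

theorem restrictCorner_extendCorner (s : Orientation n) : s.extendCorner.restrictCorner = s := rfl

theorem IsState.extendCorner_restrictCorner {t : Orientation (n + 1)} (ht : t.IsState)
    (hcorner : t.right 0 0 = false) : t.restrictCorner.extendCorner = t := by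
  refine Prod.ext (funext fun i => funext fun j => ?_) (funext fun i => funext fun j => ?_)
  · refine Fin.cases ?_ (fun i => ?_) i <;> refine Fin.cases ?_ (fun j => ?_) j
    · exact (ht.2.1 0).1.symm
    · exact (ht.first_row hcorner j).symm
    · exact (ht.2.1 i.succ).1.symm
    · rfl
  · refine Fin.cases ?_ (fun i => ?_) i
    · exact (ht.2.2 j).1.symm
    · refine Fin.cases ?_ (fun j => ?_) j
      · exact (ht.first_column hcorner i).symm
      · rfl

theorem inDegree_extendCorner_zero_zero (s : Orientation n) :
    s.extendCorner.inDegree 0 0 = 2 := by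
  simp [inDegree, left, right, above, below, extendCorner]

theorem inDegree_extendCorner_zero_succ (s : Orientation n) (j : Fin n) :
    s.extendCorner.inDegree 0 j.succ = 2 ↔ s.2 0 j = true := by
  cases h : s.2 0 j <;> simp [inDegree, left, right, above, below, extendCorner, h]

theorem inDegree_extendCorner_succ_zero (s : Orientation n) (i : Fin n) :
    s.extendCorner.inDegree i.succ 0 = 2 ↔ s.1 i 0 = true := by
  cases h : s.1 i 0 <;> simp [inDegree, left, right, above, below, extendCorner, h]

theorem inDegree_extendCorner_succ_succ (s : Orientation n) (i j : Fin n) :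
    s.extendCorner.inDegree i.succ j.succ = s.inDegree i j := rfl

theorem isState_extendCorner_iff {s : Orientation n} : s.extendCorner.IsState ↔ s.IsState := by
  simp only [IsState, Fin.forall_fin_succ (n := n), inDegree_extendCorner_zero_zero,
    inDegree_extendCorner_zero_succ, inDegree_extendCorner_succ_zero,
    inDegree_extendCorner_succ_succ]
  simp only [extendCorner, ← Fin.succ_last, Fin.cons_zero, Fin.cons_succ, forall_and]
  tauto

theorem weight_extendCorner (a t c : ℂ) (u v : Fin n → ℂ) {s : Orientation n} (hs : s.IsState) :
    s.extendCorner.weight a (Fin.cons t u) (Fin.cons c v) =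
      sigma (a ^ 2) * (∏ j, sigma (a * (t / v j)⁻¹)) * (∏ i, sigma (a * (u i / c)⁻¹)) *
        s.weight a u v := by
  have h00 (z : ℂ) : s.extendCorner.vertexWeight a 0 0 z = sigma (a ^ 2) := by
    simp [vertexWeight, left, right, extendCorner]
  have h0s (j : Fin n) (z : ℂ) :
      s.extendCorner.vertexWeight a 0 j.succ z = sigma (a * z⁻¹) := by
    simp [vertexWeight, left, right, above, extendCorner]
  have hs0 (i : Fin n) (z : ℂ) :
      s.extendCorner.vertexWeight a i.succ 0 z = sigma (a * z⁻¹) := by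
    simp [vertexWeight, left, right, above, extendCorner, hs.2.1]
  have hss (i j : Fin n) (z : ℂ) :
      s.extendCorner.vertexWeight a i.succ j.succ z = s.vertexWeight a i j z := rfl
  simp only [weight, Fin.prod_univ_succ (n := n), Fin.cons_zero, Fin.cons_succ, h00, h0s, hs0, hss,
    Finset.prod_mul_distrib]
  ring

end Orientation

theorem partitionFunction_cons_of_sigma_eq_zero {a t c : ℂ} {n : ℕ} (u v : Fin n → ℂ)
    (h : sigma (a * (t / c)) = 0) :
    partitionFunction a (n + 1) (Fin.cons t u) (Fin.cons c v) =
      sigma (a ^ 2) * (∏ j, sigma (a * (t / v j)⁻¹)) * (∏ i, sigma (a * (u i / c)⁻¹)) *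
        partitionFunction a n u v := by
  unfold partitionFunction
  rw [Finset.mul_sum]
  symm
  refine Finset.sum_of_injOn Orientation.extendCorner
    (Function.LeftInverse.injective Orientation.restrictCorner_extendCorner).injOn ?_ ?_ ?_
  · exact fun s hs => by simpa [Orientation.isState_extendCorner_iff] using hs
  · intro s hs hnot
    rw [Finset.mem_filter_univ] at hs
    have hright : s.right 0 0 = true := by
      by_contra hright
      have hext := hs.extendCorner_restrictCorner (eq_false_of_ne_true hright)
      refine hnot ⟨s.restrictCorner, ?_, hext⟩
      simpa using Orientation.isState_extendCorner_iff.1 (hext ▸ hs)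
    have hleft : s.left 0 0 = s.right 0 0 := (hs.2.1 0).1.trans hright.symm
    have hcorner : s.vertexWeight a 0 0 (t / c) = 0 := by
      rw [Orientation.vertexWeight, if_neg (not_not.2 hleft), if_pos, h]
      exact (hs.2.1 0).1.trans (hs.2.2 0).1.symm
    exact Finset.prod_eq_zero (Finset.mem_univ 0)
      (Finset.prod_eq_zero (Finset.mem_univ 0) hcorner)
  · intro s hs
    rw [Orientation.weight_extendCorner a t c u v (by simpa using hs)]

section Laurent

open Polynomial

variable {K : Type*} [Field K] {m : ℕ}

/-- The function `f` agrees away from zero with a Laurent polynomial `∑ k, c k * t ^ k`,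
where `k` ranges over the integers with `|k| ≤ m`. -/
def IsLaurentOfDegreeLE (m : ℕ) (f : K → K) : Prop :=
  ∃ p : K[X], p.natDegree ≤ 2 * m ∧ ∀ t ≠ 0, t ^ m * f t = p.eval t

theorem isLaurentOfDegreeLE_const (m : ℕ) (c : K) : IsLaurentOfDegreeLE m fun _ => c :=
  ⟨C c * X ^ m, (natDegree_C_mul_X_pow_le c m).trans (by omega), fun t _ => by
    rw [eval_mul, eval_C, eval_pow, eval_X, mul_comm]⟩

theorem isLaurentOfDegreeLE_mul_add_mul_inv (b c : K) :
    IsLaurentOfDegreeLE 1 fun t => b * t + c * t⁻¹ := by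
  refine ⟨C b * X ^ 2 + C c, by compute_degree, fun t ht => ?_⟩
  simp only [pow_one, eval_add, eval_mul, eval_C, eval_pow, eval_X]
  field_simp

namespace IsLaurentOfDegreeLE

variable {k : ℕ} {f g : K → K}

theorem mul (hf : IsLaurentOfDegreeLE m f) (hg : IsLaurentOfDegreeLE k g) :
    IsLaurentOfDegreeLE (m + k) fun t => f t * g t := by
  obtain ⟨p, hp, hpf⟩ := hf
  obtain ⟨q, hq, hqg⟩ := hg
  refine ⟨p * q, natDegree_mul_le.trans (by omega), fun t ht => ?_⟩
  rw [eval_mul, ← hpf t ht, ← hqg t ht, pow_add, mul_mul_mul_comm]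

theorem sum {ι : Type*} {s : Finset ι} {f : ι → K → K}
    (hf : ∀ i ∈ s, IsLaurentOfDegreeLE m (f i)) :
    IsLaurentOfDegreeLE m fun t => ∑ i ∈ s, f i t := by
  choose! p hp hpf using hf
  refine ⟨∑ i ∈ s, p i, natDegree_sum_le_of_forall_le _ _ hp, fun t ht => ?_⟩
  rw [Finset.mul_sum, eval_finsetSum]
  exact Finset.sum_congr rfl fun i hi => hpf i hi t ht

theorem prod {ι : Type*} {s : Finset ι} {m : ι → ℕ} {f : ι → K → K}
    (hf : ∀ i ∈ s, IsLaurentOfDegreeLE (m i) (f i)) :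
    IsLaurentOfDegreeLE (∑ i ∈ s, m i) fun t => ∏ i ∈ s, f i t := by
  choose! p hp hpf using hf
  refine ⟨∏ i ∈ s, p i, ?_, fun t ht => ?_⟩
  · rw [Finset.mul_sum]
    exact (natDegree_prod_le s p).trans (Finset.sum_le_sum hp)
  · rw [← Finset.prod_pow_eq_pow_sum, ← Finset.prod_mul_distrib, eval_prod]
    exact Finset.prod_congr rfl fun i hi => hpf i hi t ht

theorem eq_of_eq_on_nodes (hf : IsLaurentOfDegreeLE m f) (hg : IsLaurentOfDegreeLE m g)
    {ι : Type*} [Fintype ι] {z : ι → K} (hz : Function.Injective z) (hz0 : ∀ i, z i ≠ 0)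
    (hcard : 2 * m < Fintype.card ι) (heq : ∀ i, f (z i) = g (z i)) {t : K} (ht : t ≠ 0) :
    f t = g t := by
  obtain ⟨p, hp, hpf⟩ := hf
  obtain ⟨q, hq, hqg⟩ := hg
  have hpq : p - q = 0 := by
    refine eq_zero_of_natDegree_lt_card_of_eval_eq_zero _ hz (fun i => ?_)
      ((natDegree_sub_le_of_le hp hq).trans_lt (by rwa [max_self]))
    rw [eval_sub, ← hpf _ (hz0 i), ← hqg _ (hz0 i), heq, sub_self]
  rw [sub_eq_zero] at hpq
  refine mul_left_cancel₀ (pow_ne_zero m ht) ?_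
  rw [hpf t ht, hqg t ht, hpq]

end IsLaurentOfDegreeLE

variable (a : ℂ) {n : ℕ}

theorem Orientation.isLaurentOfDegreeLE_vertexWeight (s : Orientation n) (i j : Fin n) (c : ℂ) :
    IsLaurentOfDegreeLE 1 fun t => s.vertexWeight a i j (t / c) := by
  unfold Orientation.vertexWeight
  split_ifs
  · exact isLaurentOfDegreeLE_const 1 _
  · convert isLaurentOfDegreeLE_mul_add_mul_inv (a / c) (-(a / c)⁻¹) using 2 with t
    simp only [sigma, mul_inv, inv_inv, div_eq_mul_inv]
    ring
  · convert isLaurentOfDegreeLE_mul_add_mul_inv (-(a * c)⁻¹) (a * c) using 2 with t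
    simp only [sigma, mul_inv, inv_inv, div_eq_mul_inv]
    ring

theorem Orientation.IsState.isLaurentOfDegreeLE_weight {s : Orientation (n + 1)} (hs : s.IsState)
    (u : Fin n → ℂ) (y : Fin (n + 1) → ℂ) :
    IsLaurentOfDegreeLE n fun t => s.weight a (Fin.cons t u) y := by
  obtain ⟨k, hk⟩ := hs.exists_left_ne_right 0
  have hturn (z : ℂ) : s.vertexWeight a 0 k z = sigma (a ^ 2) := if_pos hk
  have hweight (t : ℂ) : s.weight a (Fin.cons t u) y =
      sigma (a ^ 2) * (∏ j, s.vertexWeight a 0 (k.succAbove j) (t / y (k.succAbove j))) *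
        ∏ i : Fin n, ∏ j, s.vertexWeight a i.succ j (u i / y j) := by
    rw [Orientation.weight, Fin.prod_univ_succ, Fin.prod_univ_succAbove _ k]
    simp only [Fin.cons_zero, Fin.cons_succ, hturn]
  have hrow : IsLaurentOfDegreeLE n fun t =>
      ∏ j : Fin n, s.vertexWeight a 0 (k.succAbove j) (t / y (k.succAbove j)) := by
    simpa using IsLaurentOfDegreeLE.prod (s := Finset.univ) (m := fun _ : Fin n => 1) fun j _ =>
      s.isLaurentOfDegreeLE_vertexWeight a 0 (k.succAbove j) (y (k.succAbove j))
  simpa only [hweight, zero_add, add_zero] using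
    ((isLaurentOfDegreeLE_const 0 _).mul hrow).mul (isLaurentOfDegreeLE_const 0 _)

theorem isLaurentOfDegreeLE_partitionFunction (u : Fin n → ℂ) (y : Fin (n + 1) → ℂ) :
    IsLaurentOfDegreeLE n fun t => partitionFunction a (n + 1) (Fin.cons t u) y :=
  IsLaurentOfDegreeLE.sum fun s hs =>
    ((Finset.mem_filter_univ s).1 hs).isLaurentOfDegreeLE_weight a u y

end Laurent

section Exchange

variable {a : ℂ} {n : ℕ} {u : Fin n → ℂ} {t : ℂ}

theorem snoc_ne_zero {M : Type*} [Zero M] {w : Fin n → M} {r : M} (hw : ∀ i, w i ≠ 0)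
    (hr : r ≠ 0) : ∀ i, (Fin.snoc w r : Fin (n + 1) → M) i ≠ 0 := by
  simpa [Fin.forall_fin_succ'] using ⟨hw, hr⟩

theorem cons_ne_zero {M : Type*} [Zero M] {w : Fin n → M} {r : M} (hr : r ≠ 0)
    (hw : ∀ i, w i ≠ 0) : ∀ i, (Fin.cons r w : Fin (n + 1) → M) i ≠ 0 := by
  simpa [Fin.forall_fin_succ] using ⟨hr, hw⟩

theorem snoc_comp_perm {α : Type*} (v : Fin n → α) (s : α) (e : Equiv.Perm (Fin n)) :
    (Fin.snoc (v ∘ e) s : Fin (n + 1) → α) =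
      (Fin.snoc v s : Fin (n + 1) → α) ∘ e.viaFintypeEmbedding Fin.castSuccEmb := by
  funext i
  refine Fin.lastCases ?_ (fun i => ?_) i
  · rw [Function.comp_apply, Equiv.Perm.viaFintypeEmbedding_apply_notMem_range _ _ (by simp)]
    simp
  · rw [Function.comp_apply, ← Fin.coe_castSuccEmb, Equiv.Perm.viaFintypeEmbedding_apply_image]
    simp

theorem continuousOn_partitionFunction_snoc {x : Fin (n + 1) → ℂ} {s : ℂ} (ha : a ≠ 0)
    (hx : ∀ i, x i ≠ 0) (hs : s ≠ 0) :
    ContinuousOn (fun v : Fin n → ℂ => partitionFunction a (n + 1) x (Fin.snoc v s))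
      {v | ∀ j, v j ≠ 0} := by
  have hsnoc : Continuous fun v : Fin n → ℂ => (x, (Fin.snoc v s : Fin (n + 1) → ℂ)) :=
    continuous_const.prodMk (Continuous.finSnoc (A := fun _ => ℂ) continuous_id continuous_const)
  have hmaps : Set.MapsTo (fun v : Fin n → ℂ => (x, (Fin.snoc v s : Fin (n + 1) → ℂ)))
      {v | ∀ j, v j ≠ 0} {p | (∀ i, p.1 i ≠ 0) ∧ ∀ j, p.2 j ≠ 0} := fun v hv =>
    ⟨hx, snoc_ne_zero hv hs⟩
  exact ((continuousOn_partitionFunction ha (n + 1)).comp hsnoc.continuousOn hmaps :)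

theorem sigma_mul_inv_of_sq_eq_one {η : ℂ} (hη : η ^ 2 = 1) (z : ℂ) :
    sigma (η * z⁻¹) = -η * sigma z := by
  have hinv : η⁻¹ = η := inv_eq_of_mul_eq_one_right (by rw [← sq, hη])
  rw [sigma, sigma, mul_inv, inv_inv, hinv]
  ring

/-- In the corner recursion, the factors of a row and of a column with the same parameter `z` differ
by a constant independent of `z`, so exchanging the parameters does not change their product. -/
theorem sigma_mul_inv_div_eq {t c z : ℂ} (ha : a ^ 6 = 1) (ht : t ≠ 0) (hc : c ≠ 0)
    (hσ : sigma (a * (t / c)) = 0) :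
    sigma (a * (t / z)⁻¹) = -(a ^ 2 * (c / t)) * sigma (a * (z / c)⁻¹) := by
  have ha0 : a ≠ 0 := (IsUnit.of_pow_eq_one ha (by norm_num)).ne_zero
  have hsq := (sigma_eq_zero_iff (mul_ne_zero ha0 (div_ne_zero ht hc))).1 hσ
  have hη : (a ^ 2 * (c / t)) ^ 2 = 1 := by
    calc (a ^ 2 * (c / t)) ^ 2 = a ^ 6 / (a * (t / c)) ^ 2 := by field_simp
      _ = 1 := by rw [ha, hsq, div_one]
  rw [← sigma_mul_inv_of_sq_eq_one hη]
  congr 1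
  field_simp

theorem injective_inv_neg_inv_self {K : Type*} [Field K] [CharZero K] {b : K} (hb : b ≠ 0)
    (hb4 : b ^ 4 ≠ 1) : Function.Injective ![b⁻¹, -b⁻¹, b] := by
  have h₀₁ : b⁻¹ ≠ -b⁻¹ := fun h => inv_ne_zero hb (self_eq_neg.1 h)
  have h₀₂ : b⁻¹ ≠ b := fun h => hb4 <| by
    have hsq : b ^ 2 = 1 := by rw [sq, ← inv_mul_cancel₀ hb, h]
    linear_combination (b ^ 2 + 1) * hsq
  have h₁₂ : -b⁻¹ ≠ b := fun h => hb4 <| by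
    have hsq : b ^ 2 = -1 := by rw [sq, ← inv_mul_cancel₀ hb, ← neg_mul, h]
    linear_combination (b ^ 2 - 1) * hsq
  intro i j hij
  fin_cases i <;> fin_cases j <;> simp_all [eq_comm]

theorem injective_mul_of_norm_eq_one {K ι κ : Type*} [NormedField K] {ε : ι → K} {v : κ → K}
    (hε : Function.Injective ε) (hε1 : ∀ i, ‖ε i‖ = 1) (hv0 : ∀ j, v j ≠ 0)
    (hv : Function.Injective fun j => ‖v j‖) :
    Function.Injective fun k : ι × κ => ε k.1 * v k.2 := by
  rintro ⟨i, j⟩ ⟨i', j'⟩ h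
  obtain rfl : j = j' := hv (by simpa [hε1] using congrArg norm h)
  exact Prod.ext (hε (mul_right_cancel₀ (hv0 j) h)) rfl

/-- The invariance of the partition function under the exchange of the last row parameter with the
last column parameter, when these are `s` and `t` and the other row and column parameters are `u`
and `v`. -/
def Exchangeable (a : ℂ) (u v : Fin n → ℂ) (s t : ℂ) : Prop :=
  partitionFunction a (n + 1) (Fin.snoc u t) (Fin.snoc v s) =
    partitionFunction a (n + 1) (Fin.snoc u s) (Fin.snoc v t)

theorem partitionFunction_one (a : ℂ) (x y : Fin 1 → ℂ) :
    partitionFunction a 1 x y = ∑ s : Orientation 1 with s.IsState, sigma (a ^ 2) := by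
  refine Finset.sum_congr rfl fun s hs => ?_
  obtain ⟨j, hj⟩ := ((Finset.mem_filter_univ s).1 hs).exists_left_ne_right 0
  rw [Subsingleton.elim j 0] at hj
  rw [Orientation.weight, Fin.prod_univ_one, Fin.prod_univ_one]
  exact if_pos hj

namespace Exchangeable

variable {v : Fin n → ℂ} {s : ℂ}

theorem of_fin_zero (a : ℂ) (u v : Fin 0 → ℂ) (s t : ℂ) : Exchangeable a u v s t :=
  (partitionFunction_one a _ _).trans (partitionFunction_one a _ _).symm

theorem cons_cons_of_sigma_eq_zero {t₀ c : ℂ} (ha : a ^ 6 = 1) (ht₀ : t₀ ≠ 0) (hc : c ≠ 0)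
    (hσ : sigma (a * (t₀ / c)) = 0) (h : Exchangeable a u v s t) :
    Exchangeable a (Fin.cons t₀ u : Fin (n + 1) → ℂ) (Fin.cons c v) s t := by
  unfold Exchangeable at h ⊢
  simp only [← Fin.cons_snoc_eq_snoc_cons, partitionFunction_cons_of_sigma_eq_zero _ _ hσ,
    h, Fin.prod_univ_castSucc, Fin.snoc_castSucc, Fin.snoc_last,
    sigma_mul_inv_div_eq (z := s) ha ht₀ hc hσ, sigma_mul_inv_div_eq (z := t) ha ht₀ hc hσ]
  ring

theorem comp_perm_iff (ha : a ≠ 0) (hu : ∀ i, u i ≠ 0) (hv : ∀ j, v j ≠ 0) (hs : s ≠ 0)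
    (ht : t ≠ 0) (e : Equiv.Perm (Fin n)) :
    Exchangeable a u (v ∘ e) s t ↔ Exchangeable a u v s t := by
  unfold Exchangeable
  rw [snoc_comp_perm, snoc_comp_perm,
    partitionFunction_comp_perm_right ha (snoc_ne_zero hu ht) (snoc_ne_zero hv hs),
    partitionFunction_comp_perm_right ha (snoc_ne_zero hu hs) (snoc_ne_zero hv ht)]

theorem inv_iff (ha : a ≠ 0) (hu : ∀ i, u i ≠ 0) (hv : ∀ j, v j ≠ 0) (hs : s ≠ 0)
    (ht : t ≠ 0) : Exchangeable a u⁻¹ v⁻¹ s⁻¹ t⁻¹ ↔ Exchangeable a u v s t := by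
  have hsnoc (w : Fin n → ℂ) (r : ℂ) :
      (Fin.snoc w⁻¹ r⁻¹ : Fin (n + 1) → ℂ) = (Fin.snoc w r : Fin (n + 1) → ℂ)⁻¹ :=
    (Fin.comp_snoc Inv.inv w r).symm
  unfold Exchangeable
  rw [hsnoc, hsnoc, hsnoc, hsnoc,
    partitionFunction_inv ha (snoc_ne_zero hu ht) (snoc_ne_zero hv hs),
    partitionFunction_inv ha (snoc_ne_zero hu hs) (snoc_ne_zero hv ht)]

theorem cons_of_sigma_eq_zero {v : Fin (n + 1) → ℂ} {t₀ : ℂ} (ha : a ^ 6 = 1)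
    (hu : ∀ i, u i ≠ 0) (hv : ∀ j, v j ≠ 0) (hs : s ≠ 0) (ht : t ≠ 0) (ht₀ : t₀ ≠ 0)
    (ih : ∀ v : Fin n → ℂ, (∀ j, v j ≠ 0) → Exchangeable a u v s t)
    {j : Fin (n + 1)} (hσ : sigma (a * (t₀ / v j)) = 0) :
    Exchangeable a (Fin.cons t₀ u : Fin (n + 1) → ℂ) v s t := by
  have ha0 : a ≠ 0 := (IsUnit.of_pow_eq_one ha (by norm_num)).ne_zero
  rw [← comp_perm_iff ha0 (cons_ne_zero ht₀ hu) hv hs ht (Equiv.swap 0 j),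
    ← Fin.cons_self_tail (v ∘ Equiv.swap 0 j)]
  refine (ih _ fun k => hv _).cons_cons_of_sigma_eq_zero ha ht₀ (hv _) ?_
  rwa [Function.comp_apply, Equiv.swap_apply_left]

theorem cons_of_sigma_inv_eq_zero {v : Fin (n + 1) → ℂ} {t₀ : ℂ} (ha : a ^ 6 = 1)
    (hu : ∀ i, u i ≠ 0) (hv : ∀ j, v j ≠ 0) (hs : s ≠ 0) (ht : t ≠ 0) (ht₀ : t₀ ≠ 0)
    (ih : ∀ v : Fin n → ℂ, (∀ j, v j ≠ 0) → Exchangeable a u v s t)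
    {j : Fin (n + 1)} (hσ : sigma (a * (t₀ / v j)⁻¹) = 0) :
    Exchangeable a (Fin.cons t₀ u : Fin (n + 1) → ℂ) v s t := by
  have ha0 : a ≠ 0 := (IsUnit.of_pow_eq_one ha (by norm_num)).ne_zero
  have hcons : (Fin.cons t₀ u : Fin (n + 1) → ℂ)⁻¹ = Fin.cons t₀⁻¹ u⁻¹ :=
    Fin.comp_cons Inv.inv t₀ u
  rw [← inv_iff ha0 (cons_ne_zero ht₀ hu) hv hs ht, hcons]
  refine cons_of_sigma_eq_zero ha (fun i => inv_ne_zero (hu i)) (fun j => inv_ne_zero (hv j))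
    (inv_ne_zero hs) (inv_ne_zero ht) (inv_ne_zero ht₀) (fun w hw => ?_)
    (j := j) (by rwa [Pi.inv_apply, inv_div_inv, ← inv_div])
  have hw' : ∀ j, w⁻¹ j ≠ 0 := fun j => inv_ne_zero (hw j)
  rw [← inv_inv w, inv_iff ha0 hu hw' hs ht]
  exact ih _ hw'

theorem cons_of_mem_genericVectors {v : Fin (n + 1) → ℂ} {t₀ : ℂ} (ha : a ^ 6 = 1)
    (ha2 : a ^ 2 ≠ 1) (hu : ∀ i, u i ≠ 0) (hv : v ∈ genericVectors (n + 1) 1) (hs : s ≠ 0)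
    (ht : t ≠ 0) (ht₀ : t₀ ≠ 0)
    (ih : ∀ v : Fin n → ℂ, (∀ j, v j ≠ 0) → Exchangeable a u v s t) :
    Exchangeable a (Fin.cons t₀ u : Fin (n + 1) → ℂ) v s t := by
  obtain ⟨hv0, hnorm⟩ := hv
  have ha0 : a ≠ 0 := (IsUnit.of_pow_eq_one ha (by norm_num)).ne_zero
  have ha4 : a ^ 4 ≠ 1 := fun h => ha2 (by linear_combination ha - a ^ 2 * h)
  have ha1 : ‖a‖ = 1 := Complex.norm_eq_one_of_pow_eq_one ha (by norm_num)
  have hroot (k : Fin 3) : ‖![a⁻¹, -a⁻¹, a] k‖ = 1 := by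
    fin_cases k <;> simp [ha1]
  have hnode (k : Fin 3 × Fin (n + 1)) : ![a⁻¹, -a⁻¹, a] k.1 * v k.2 ≠ 0 :=
    mul_ne_zero (norm_ne_zero_iff.1 (by simp [hroot])) (hv0 k.2)
  have hinj : Function.Injective fun k : Fin 3 × Fin (n + 1) => ![a⁻¹, -a⁻¹, a] k.1 * v k.2 :=
    injective_mul_of_norm_eq_one (injective_inv_neg_inv_self ha0 ha4) hroot hv0
      fun i j hij => by_contra fun h => hnorm i j h (by simpa using hij)
  unfold Exchangeable
  simp only [← Fin.cons_snoc_eq_snoc_cons]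
  refine (isLaurentOfDegreeLE_partitionFunction a _ _).eq_of_eq_on_nodes
    (isLaurentOfDegreeLE_partitionFunction a _ _) hinj hnode ?_ (fun k => ?_) ht₀
  · simp only [Fintype.card_prod, Fintype.card_fin]
    omega
  · simp only [Fin.cons_snoc_eq_snoc_cons]
    obtain ⟨k, j⟩ := k
    have hcons := cons_of_sigma_eq_zero ha hu hv0 hs ht (hnode (k, j)) ih (j := j)
    have hcons_inv := cons_of_sigma_inv_eq_zero ha hu hv0 hs ht (hnode (k, j)) ih (j := j)
    fin_cases k
    · exact hcons (by simp [sigma, hv0 j, ha0])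
    · exact hcons (by simp [sigma, hv0 j, ha0, neg_div])
    · exact hcons_inv (by simp [sigma, hv0 j, ha0])

theorem cons {v : Fin (n + 1) → ℂ} {t₀ : ℂ} (ha : a ^ 6 = 1) (ha2 : a ^ 2 ≠ 1)
    (hu : ∀ i, u i ≠ 0) (hv : ∀ j, v j ≠ 0) (hs : s ≠ 0) (ht : t ≠ 0) (ht₀ : t₀ ≠ 0)
    (ih : ∀ v : Fin n → ℂ, (∀ j, v j ≠ 0) → Exchangeable a u v s t) :
    Exchangeable a (Fin.cons t₀ u : Fin (n + 1) → ℂ) v s t := by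
  have ha0 : a ≠ 0 := (IsUnit.of_pow_eq_one ha (by norm_num)).ne_zero
  let Z (p q : ℂ) (w : Fin (n + 1) → ℂ) : ℂ :=
    partitionFunction a (n + 2) (Fin.snoc (Fin.cons t₀ u : Fin (n + 1) → ℂ) p) (Fin.snoc w q)
  have hcont {p q : ℂ} (hp : p ≠ 0) (hq : q ≠ 0) : ContinuousOn (Z p q) {w | ∀ j, w j ≠ 0} :=
    continuousOn_partitionFunction_snoc ha0 (snoc_ne_zero (cons_ne_zero ht₀ hu) hp) hq
  have hgeneric : Set.EqOn (Z t s) (Z s t) (genericVectors (n + 1) 1) := fun w hw =>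
    cons_of_mem_genericVectors ha ha2 hu hw hs ht ht₀ ih
  exact hgeneric.of_subset_closure (hcont ht hs) (hcont hs ht) (fun w hw => hw.1)
    (fun w hw => mem_closure_genericVectors 1 hw) hv

end Exchangeable

theorem exchangeable (ha : a ^ 6 = 1) (ha2 : a ^ 2 ≠ 1) {v : Fin n → ℂ} {s : ℂ}
    (hu : ∀ i, u i ≠ 0) (hv : ∀ j, v j ≠ 0) (hs : s ≠ 0) (ht : t ≠ 0) :
    Exchangeable a u v s t := by
  induction n with
  | zero => exact .of_fin_zero a u v s t
  | succ n ih =>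
    rw [← Fin.cons_self_tail u]
    exact .cons ha ha2 (fun i => hu _) hv hs ht (hu 0) fun w hw => ih (fun i => hu _) hw

end Exchange

section SymmetryGroup

variable {a : ℂ} {n : ℕ}

/-- The permutations of the `2 * n` row and column parameters, `Sum.inl i` standing for the `i`-th
row and `Sum.inr j` for the `j`-th column, that leave the partition function unchanged at all
nonzero values of the parameters. -/
def symmetryGroup (a : ℂ) (n : ℕ) : Subgroup (Equiv.Perm (Fin n ⊕ Fin n)) where
  carrier := {e | ∀ f : Fin n ⊕ Fin n → ℂ, (∀ k, f k ≠ 0) →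
    partitionFunction a n (f ∘ e ∘ Sum.inl) (f ∘ e ∘ Sum.inr) =
      partitionFunction a n (f ∘ Sum.inl) (f ∘ Sum.inr)}
  one_mem' _ _ := rfl
  mul_mem' {e _} he he' f hf := (he' (f ∘ ⇑e) fun _ => hf _).trans (he f hf)
  inv_mem' {e} he f hf := by
    simpa [Function.comp_def] using (he (f ∘ ⇑e⁻¹) fun _ => hf _).symm

theorem sumCongr_mem_symmetryGroup (ha : a ≠ 0) (e e' : Equiv.Perm (Fin n)) :
    Equiv.Perm.sumCongr e e' ∈ symmetryGroup a n := fun _ hf =>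
  (partitionFunction_comp_perm_left ha (fun _ => hf _) (fun _ => hf _) e).trans
    (partitionFunction_comp_perm_right ha (fun _ => hf _) (fun _ => hf _) e')

theorem swap_last_mem_symmetryGroup (ha : a ^ 6 = 1) (ha2 : a ^ 2 ≠ 1) :
    Equiv.swap (Sum.inl (Fin.last n)) (Sum.inr (Fin.last n)) ∈ symmetryGroup a (n + 1) := by
  intro f hf
  have h := exchangeable (u := f ∘ Sum.inl ∘ Fin.castSucc) (v := f ∘ Sum.inr ∘ Fin.castSucc)
    ha ha2 (fun _ => hf _) (fun _ => hf _) (hf (Sum.inl (Fin.last n))) (hf (Sum.inr (Fin.last n)))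
  unfold Exchangeable at h
  convert h using 2 <;> funext k <;> refine Fin.lastCases ?_ (fun k => ?_) k <;>
    simp [Equiv.swap_apply_of_ne_of_ne]

theorem swap_inl_inr_mem_symmetryGroup (ha : a ^ 6 = 1) (ha2 : a ^ 2 ≠ 1) (i j : Fin n) :
    Equiv.swap (Sum.inl i) (Sum.inr j) ∈ symmetryGroup a n := by
  obtain _ | n := n
  · exact i.elim0
  have ha0 : a ≠ 0 := (IsUnit.of_pow_eq_one ha (by norm_num)).ne_zero
  let g := Equiv.Perm.sumCongr (Equiv.swap i (Fin.last n)) (Equiv.swap j (Fin.last n))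
  have hg : g ∈ symmetryGroup a (n + 1) := sumCongr_mem_symmetryGroup ha0 _ _
  have hconj : Equiv.swap (Sum.inl i) (Sum.inr j) =
      g * Equiv.swap (Sum.inl (Fin.last n)) (Sum.inr (Fin.last n)) * g⁻¹ := by
    rw [← Equiv.swap_apply_apply]
    simp [g]
  rw [hconj]
  exact mul_mem (mul_mem hg (swap_last_mem_symmetryGroup ha ha2)) (inv_mem hg)

theorem swap_mem_symmetryGroup (ha : a ^ 6 = 1) (ha2 : a ^ 2 ≠ 1) :
    ∀ k l : Fin n ⊕ Fin n, Equiv.swap k l ∈ symmetryGroup a n := by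
  have ha0 : a ≠ 0 := (IsUnit.of_pow_eq_one ha (by norm_num)).ne_zero
  rintro (i | i) (j | j)
  · rw [← Equiv.Perm.sumCongr_swap_refl]
    exact sumCongr_mem_symmetryGroup ha0 _ _
  · exact swap_inl_inr_mem_symmetryGroup ha ha2 i j
  · rw [Equiv.swap_comm]
    exact swap_inl_inr_mem_symmetryGroup ha ha2 j i
  · rw [← Equiv.Perm.sumCongr_refl_swap]
    exact sumCongr_mem_symmetryGroup ha0 _ _

theorem symmetryGroup_eq_top (ha : a ^ 6 = 1) (ha2 : a ^ 2 ≠ 1) : symmetryGroup a n = ⊤ := by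
  rw [← top_le_iff, ← Equiv.Perm.closure_isSwap, Subgroup.closure_le]
  rintro _ ⟨k, l, _, rfl⟩
  exact swap_mem_symmetryGroup ha ha2 k l

end SymmetryGroup

theorem isPrimitiveRoot_exp_I_mul_pi_div_three_sq :
    IsPrimitiveRoot (Complex.exp (Complex.I * (Real.pi : ℂ) / 3) ^ 2) 3 := by
  convert Complex.isPrimitiveRoot_exp 3 (by norm_num) using 1
  rw [← Complex.exp_nat_mul]
  push_cast
  ring_nf

end SquareIce

theorem mainTheorem8_general {a : ℂ} (ha : IsPrimitiveRoot (a ^ 2) 3) (n : ℕ) (x y : Fin n → ℂ)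
    (hx : ∀ i, x i ≠ 0) (hy : ∀ j, y j ≠ 0) (π : Equiv.Perm (Fin n ⊕ Fin n)) :
    SquareIce.partitionFunction a n
        (fun i => Sum.elim x y (π (Sum.inl i))) (fun j => Sum.elim x y (π (Sum.inr j))) =
      SquareIce.partitionFunction a n x y := by
  have ha6 : a ^ 6 = 1 := by rw [← ha.pow_eq_one, ← pow_mul]
  have hπ : π ∈ SquareIce.symmetryGroup a n :=
    SquareIce.symmetryGroup_eq_top ha6 (ha.ne_one (by norm_num)) ▸ Subgroup.mem_top π
  exact hπ (Sum.elim x y) (by simp [hx, hy])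

theorem mainTheorem8 (n : ℕ) (x y : Fin n → ℂ) (hx : ∀ i, x i ≠ 0) (hy : ∀ j, y j ≠ 0)
    (π : Equiv.Perm (Fin n ⊕ Fin n)) :
    SquareIce.partitionFunction (Complex.exp (Complex.I * (Real.pi : ℂ) / 3)) n
        (fun i => Sum.elim x y (π (Sum.inl i))) (fun j => Sum.elim x y (π (Sum.inr j))) =
      SquareIce.partitionFunction (Complex.exp (Complex.I * (Real.pi : ℂ) / 3)) n x y :=
  mainTheorem8_general SquareIce.isPrimitiveRoot_exp_I_mul_pi_div_three_sq n x y hx hy π
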